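/- Let $\mathbb{T}=\mathbb{R}\cup\{-\infty\}$ be the tropical semiring (addition is maximum, multiplication is $+$), and let $UT_n(\mathbb{T})$ be the multiplicative semigroup of all $n\times n$ upper triangular matrices over $\mathbb{T}$ (entries $-\infty$ below the diagonal). A semigroup identity $u=v$ is a pair of distinct non-empty words over an alphabet $\Sigma$; a semigroup $S$ satisfies it if every morphism $\Sigma^+\to S$ sends $u$ and $v$ to the same element. The variety generated by $S$ is the class of all semigroups that satisfy every semigroup identity satisfied by $S$. For a word $w\in\{a,b\}^+$, $w[ab,ba]$ is the word obtained from $w$ by substituting $ab$ for $a$ and $ba$ for $b$ simultaneously. A word $w$ is a factor of a word $v$ if $v=v_1wv_2$ for some, possibly empty, words $v_1,v_2$. Theorem. (1) For every positive integer $n$ there is a semigroup identity, over $\{a,b\}$, that is satisfied by $UT_n(\mathbb{T})$ but not by $UT_{n+1}(\mathbb{T})$. (2) The varieties generated by the semigroups $UT_n(\mathbb{T})$, $n\ge 1$, are pairwise distinct. (3) Explicitly, for $n\ge1$ define a word $\bar u\in\{a,b\}^*$ as follows. For $n=1,2,3$ let $\bar u$ be the empty word, $ab$, and $ab^2a^2b$,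 respectively. For $n\ge 4$ let $w_1,\dots,w_m$ be a complete list without repetition, in any order, of the words of length $n-1$ over $\{a,b\}$. If $n$ is even, let $\tilde w=b(ab)^{(n-2)/2}$, let $w_i'$ be obtained from $w_i$ by removing the prefix $b^2$ if there is one and then the suffix $a^2$ if there is one, and let $$\bar u=\tilde w\,ba\,(b^2w_1'a^2)(b^2w_2'a^2)\cdots(b^2w_m'a^2)\,b^2a.$$ If $n$ is odd, let $\tilde w=(ba)^{(n-1)/2}$, let $w_i'$ be obtained from $w_i$ by removing the prefix $b^2$ if there is one and then the suffix $b^2$ if there is one, and let $$\bar u=\tilde w\,(b^2w_1'b^2)a\,(b^2w_2'b^2)a\cdots(b^2w_m'b^2)a.$$ Then, for every $n\ge 1$ and every such list, the identity $$\bar u\,a\,\bar u[ab,ba]=\bar u\,b\,\bar u[ab,ba]$$ (the substitution being applied to the whole words $\bar u a\bar u$ and $\bar u b\bar u$) is satisfied by $UT_n(\mathbb{T})$; some word of length $n$ is a factor of exactly one of $\bar u a\bar u$ and $\bar u b\bar u$; and the identity is not satisfied by $UT_{n+1}(\mathbb{T})$. -/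

import Mathlib

namespace TropicalVarieties

/-! ### Semigroup identities and varieties -/

/-- The semigroup `S` satisfies the identity `u = v` between non-empty words over the alphabet `α`:
every morphism from the free semigroup `α⁺` to `S` sends `u` and `v` to the same element. -/
def Satisfies (S : Type*) [Semigroup S] {α : Type*} (u v : FreeSemigroup α) : Prop :=
  ∀ φ : FreeSemigroup α →ₙ* S, φ u = φ v

/-- The variety generated by `S`: the class of all semigroups that satisfy all the semigroup
identities (over all alphabets) that `S` satisfies. -/
def variety (S : Type) [Semigroup S] : Set Semigrp.{0} :=
  {T | ∀ (α : Type) (u v : FreeSemigroup α), Satisfies S u v → Satisfies T u v}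

/-- The two-letter alphabet `{a, b}`. -/
inductive Letter : Type
  | a : Letter
  | b : Letter

open Letter

/-- The evaluation `w(x, y)` of a word `w ∈ {a, b}⁺` in a semigroup, under `a ↦ x`, `b ↦ y`.
For `S = {a, b}⁺` this is the word `w[x, y]`. -/
def eval {S : Type*} [Semigroup S] (x y : S) : FreeSemigroup Letter →ₙ* S :=
  FreeSemigroup.lift fun c => match c with
    | a => x
    | b => y

/-- A non-empty list of letters as an element of `{a, b}⁺`. -/
def toWord (l : List Letter) (h : l ≠ []) : FreeSemigroup Letter :=
  ⟨l.head h, l.tail⟩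

/-- The word `ū c ū`. -/
def sandwich (ū : List Letter) (c : Letter) : List Letter := ū ++ c :: ū

/-- The word `ū c ū[ab, ba]`. -/
def sandwichSubst (ū : List Letter) (c : Letter) : FreeSemigroup Letter :=
  eval (FreeSemigroup.of a * FreeSemigroup.of b) (FreeSemigroup.of b * FreeSemigroup.of a)
    (toWord (sandwich ū c) (by simp [sandwich]))

/-! ### Upper triangular tropical matrices -/

/-- The (max-plus) tropical semiring on `ℝ ∪ {-∞}`. Mathlib's `Tropical R` has the minimum of `R` as
its addition; in `WithTop ℝᵒᵈ` the order of `ℝ` is reversed, so the minimum there is the maximum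
of `ℝ`, and the top element is `-∞`. -/
abbrev 𝕋 : Type := Tropical (WithTop ℝᵒᵈ)

/-- A real number as an element of `𝕋`. -/
def ofReal (x : ℝ) : 𝕋 := Tropical.trop ((OrderDual.toDual x : ℝᵒᵈ) : WithTop ℝᵒᵈ)

theorem eq_zero_or_eq_ofReal (t : 𝕋) : t = 0 ∨ ∃ x : ℝ, t = ofReal x := by
  induction t using Tropical.tropRec with
  | h t =>
    induction t using WithTop.recTopCoe with
    | top => exact Or.inl rfl
    | coe x => exact Or.inr ⟨OrderDual.ofDual x, rfl⟩

theorem ofReal_ne_zero (x : ℝ) : ofReal x ≠ 0 := Tropical.trop_coe_ne_zero _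

theorem ofReal_injective : Function.Injective ofReal := fun x y h => by
  simpa [ofReal] using h

theorem ofReal_add_ofReal (x y : ℝ) : ofReal x + ofReal y = ofReal (max x y) := rfl

theorem ofReal_mul_ofReal (x y : ℝ) : ofReal x * ofReal y = ofReal (x + y) := rfl

/-- `UT_n(𝕋)`: the multiplicative semigroup of all `n × n` upper triangular matrices over `𝕋`, with
`-∞` (the zero of `𝕋`) below the diagonal. -/
def UT (n : ℕ) : Subsemigroup (Matrix (Fin n) (Fin n) 𝕋) where
  carrier := {A | ∀ i j, j < i → A i j = 0}
  mul_mem' {A B} hA hB i j hij := by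
    rw [Matrix.mul_apply]
    refine Finset.sum_eq_zero fun k _ => ?_
    rcases lt_or_ge k i with h | h
    · rw [hA i k h, zero_mul]
    · rw [hB k j (lt_of_lt_of_le hij h), mul_zero]

/-! ### The words `ū` -/

/-- The concatenation power `x ^ k` of a word. -/
def wordPow (x : List Letter) (k : ℕ) : List Letter := (List.replicate k x).flatten

/-- Remove the prefix `c²`, if there is one. -/
def dropSqPrefix : Letter → List Letter → List Letter
  | a, a :: a :: x => x
  | b, b :: b :: x => x
  | _, x => x

/-- Remove the suffix `c²`, if there is one. -/
def dropSqSuffix (c : Letter) (x : List Letter) : List Letter :=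
  (dropSqPrefix c x.reverse).reverse

/-- `L` is a complete list, without repetition and in any order, of the words of length `k`
over `{a, b}`. -/
def IsWordListing (k : ℕ) (L : List (List Letter)) : Prop :=
  L.Nodup ∧ ∀ x, x ∈ L ↔ x.length = k

/-- The alternating word `bab⋯` of length `n - 1`: `b(ab)^((n-2)/2)` for even `n`,
`(ba)^((n-1)/2)` for odd `n`. -/
def alternating (n : ℕ) : List Letter :=
  if Even n then b :: wordPow [a, b] ((n - 2) / 2) else wordPow [b, a] ((n - 1) / 2)

/-- The word `ū`, for `n ≥ 1` and a complete list `L` of the words of length `n - 1` (which is used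
for `n ≥ 4` only): empty for `n = 1`, `ab` for `n = 2`, `ab²a²b` for `n = 3`. -/
def uBar (n : ℕ) (L : List (List Letter)) : List Letter :=
  if n ≤ 1 then []
  else if n = 2 then [a, b]
  else if n = 3 then [a, b, b, a, a, b]
  else if Even n then
    alternating n ++ [b, a] ++
      L.flatMap (fun x => [b, b] ++ dropSqSuffix a (dropSqPrefix b x) ++ [a, a]) ++ [b, b, a]
  else
    alternating n ++
      L.flatMap (fun x => [b, b] ++ dropSqSuffix b (dropSqPrefix b x) ++ [b, b] ++ [a])

end TropicalVarieties

open TropicalVarieties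

/-!
An entry `(i, j)` of a product of upper triangular tropical matrices along a word is the best
weight of a run, a nondecreasing sequence of states from `i` to `j` that stays in a loop or moves
on at each letter. Everything below rests on this.

*The identity holds in `UT_n(𝕋)`.* After the substitution the letters stand for `AB` and `BA`,
which have the same diagonal, so a loop has the same weight at both letters. A run moves on at
most `n - 1` times, and every word of length less than `n` is a factor of `ū`. Take an optimal run
over `ū c ū` and cut it at the state whose loop is the best among those it uses. The central
letter lies before or after the cut. If it lies before, let `α s` be a prefix of `ū`, where `s` is
the word of the letters at which the run moves on before the cut. The run is followed until it has
made `|α|` loops, then it moves on at every letter; all its moves towards the cut then fall into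
the first copy of `ū`, and the loops it gives up are replaced by the best one
(`Run.wordProd_prefix_mul_pow_le`). If it lies after the cut, the mirror image
`Run.pow_mul_wordProd_suffix_le` applies. Either way the central letter is read in a loop, so it
may be changed (`wordProd_sandwich_le`).

*The identity fails in `UT_N(𝕋)` for `N > n`.* Some word `s` of length `n` is a factor of exactly
one of `ū a ū` and `ū b ū`. There are a bidiagonal `A` and a diagonal `B` such that in `AB` and
`BA` the step out of state `i` is free exactly at the `i`-th letter of `s`, loops are free at the
states `0` and `n` and cost `1` at the states between. The entry `(0, n)` along a word is then `0`
if `s` is a factor of the word and at most `-1` otherwise (`wordProd_detect_le_of_infix`,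
`le_wordProd_detect_of_not_infix`).

*The distinguishing factor.* For `n ≥ 4` it is the alternating word `abab⋯` of length `n`. A word
without squares of letters that is a factor of `x c c y` is a factor of `x c` or of `c y`, so `ū b
ū` can be cut at its squares into pieces that are either shorter than `n` or visibly do not
contain the alternating word (`alt_infix_sandwich`).

The order on `𝕋` is that of Mathlib's min-plus `Tropical`: `t ≤ t'` says that `t` is the larger of
the two as an element of `ℝ ∪ {-∞}`, and `0` (that is, `-∞`) is the greatest element.
-/

namespace TropicalVarieties

open Letter

/-! ### Letters and word listings -/

instance : DecidableEq Letter
  | a, a => isTrue rfl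
  | a, b => isFalse nofun
  | b, a => isFalse nofun
  | b, b => isTrue rfl

instance : Finite Letter :=
  Finite.of_injective (fun c : Letter => decide (c = a)) fun c d h => by
    cases c <;> cases d <;> simp_all

theorem exists_isWordListing (k : ℕ) : ∃ L, IsWordListing k L := by
  have h : {x : List Letter | x.length = k}.Finite := List.finite_length_eq Letter k
  exact ⟨h.toFinset.toList, h.toFinset.nodup_toList, fun x => by simp⟩

/-! ### Products of matrices along words -/

section Products

theorem sum_le_apply {ι : Type*} (s : Finset ι) (f : ι → 𝕋) {i : ι} (hi : i ∈ s) :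
    ∑ k ∈ s, f k ≤ f i := by
  rw [← Tropical.untrop_le_iff, Finset.untrop_sum']
  exact Finset.inf_le hi

theorem le_sum_of_forall_le {ι : Type*} (s : Finset ι) (f : ι → 𝕋) {t : 𝕋}
    (h : ∀ i ∈ s, t ≤ f i) : t ≤ ∑ k ∈ s, f k := by
  rw [← Tropical.untrop_le_iff, Finset.untrop_sum']
  exact Finset.le_inf h

theorem exists_sum_eq_apply {ι : Type*} (s : Finset ι) (hs : s.Nonempty) (f : ι → 𝕋) :
    ∃ i ∈ s, ∑ k ∈ s, f k = f i := by
  obtain ⟨i, hi, h⟩ := Finset.exists_mem_eq_inf s hs (Tropical.untrop ∘ f)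
  refine ⟨i, hi, Tropical.untrop_injective ?_⟩
  rw [Finset.untrop_sum', h, Function.comp_apply]

variable {N : ℕ}

/-- The product of the matrices `M c` over the letters `c` of the word `w`. -/
noncomputable def wordProd (M : Letter → Matrix (Fin N) (Fin N) 𝕋) (w : List Letter) :
    Matrix (Fin N) (Fin N) 𝕋 := (w.map M).prod

variable {M : Letter → Matrix (Fin N) (Fin N) 𝕋}

@[simp] theorem wordProd_nil : wordProd M [] = 1 := rfl

theorem wordProd_cons (c : Letter) (w : List Letter) :
    wordProd M (c :: w) = M c * wordProd M w := by simp [wordProd]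

theorem wordProd_append (v w : List Letter) :
    wordProd M (v ++ w) = wordProd M v * wordProd M w := by simp [wordProd]

theorem wordProd_concat (w : List Letter) (c : Letter) :
    wordProd M (w ++ [c]) = wordProd M w * M c := by simp [wordProd]

theorem wordProd_append_le (v w : List Letter) (i k j : Fin N) :
    wordProd M (v ++ w) i j ≤ wordProd M v i k * wordProd M w k j := by
  rw [wordProd_append, Matrix.mul_apply]
  exact sum_le_apply _ _ (Finset.mem_univ k)

theorem wordProd_cons_le (c : Letter) (w : List Letter) (i k j : Fin N) :
    wordProd M (c :: w) i j ≤ M c i k * wordProd M w k j := by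
  rw [wordProd_cons, Matrix.mul_apply]
  exact sum_le_apply _ _ (Finset.mem_univ k)

theorem wordProd_diag_le {D : 𝕋} {k : Fin N} (hD : ∀ c, M c k k = D) (w : List Letter) :
    wordProd M w k k ≤ D ^ w.length := by
  induction w with
  | nil => simp
  | cons c w ih =>
    refine (wordProd_cons_le c w k k k).trans ?_
    rw [hD, List.length_cons, pow_succ']
    exact mul_le_mul_right ih D

/-- A homomorphism to a matrix semigroup evaluates a word as the product along its letters. -/
theorem map_toWord (ψ : FreeSemigroup Letter →ₙ* Matrix (Fin N) (Fin N) 𝕋) (l : List Letter)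
    (h : l ≠ []) : ψ (toWord l h) = wordProd (fun c => ψ (FreeSemigroup.of c)) l := by
  induction l with
  | nil => exact absurd rfl h
  | cons c l ih =>
    rcases l with _ | ⟨e, l⟩
    · simp [wordProd]; rfl
    · rw [wordProd_cons, ← ih (by simp), ← map_mul]; rfl

end Products

/-! ### Runs through an upper triangular matrix -/

section Runs

variable {N : ℕ}

/-- `Run M D k x s m ω`: reading the word `x` along a nondecreasing sequence of states from `k` to
`m` has weight `ω`; the subword `s` of `x` consists of the letters at which the state changes, and
`D` is at least as good a weight as each of the loops used (`D ≤ _` in the order of `𝕋`, in which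
smaller means larger as a real number). -/
inductive Run (M : Letter → Matrix (Fin N) (Fin N) 𝕋) (D : 𝕋) :
    Fin N → List Letter → List Letter → Fin N → 𝕋 → Prop
  | nil (m : Fin N) : Run M D m [] [] m 1
  | loop {k m : Fin N} {x s : List Letter} {ω : 𝕋} (c : Letter) (hD : D ≤ M c k k)
      (r : Run M D k x s m ω) : Run M D k (c :: x) s m (M c k k * ω)
  | step {k l m : Fin N} {x s : List Letter} {ω : 𝕋} (c : Letter) (hkl : k < l)
      (r : Run M D l x s m ω) : Run M D k (c :: x) (c :: s) m (M c k l * ω)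

variable {M : Letter → Matrix (Fin N) (Fin N) 𝕋} {D : 𝕋} {k m : Fin N} {x s : List Letter} {ω : 𝕋}

namespace Run

theorem mono {E : 𝕋} (hE : E ≤ D) (r : Run M D k x s m ω) : Run M E k x s m ω := by
  induction r with
  | nil m => exact .nil m
  | loop c hD _ ih => exact .loop c (hE.trans hD) ih
  | step c h _ ih => exact .step c h ih

theorem append {j : Fin N} {y t : List Letter} {θ : 𝕋} (r : Run M D k x s m ω)
    (q : Run M D m y t j θ) : Run M D k (x ++ y) (s ++ t) j (ω * θ) := by
  induction r with
  | nil m => simpa using q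
  | loop c hD _ ih => rw [mul_assoc]; exact .loop c hD (ih q)
  | step c h _ ih => rw [mul_assoc]; exact .step c h (ih q)

theorem add_length_le (r : Run M D k x s m ω) : (k : ℕ) + s.length ≤ m := by
  induction r with
  | nil m => simp
  | loop c hD _ ih => exact ih
  | step c h _ ih =>
    have : (_ : ℕ) < _ := h
    simp only [List.length_cons]; omega

theorem wordProd_le (r : Run M D k x s m ω) : wordProd M x k m ≤ ω := by
  induction r with
  | nil m => simp
  | loop c hD _ ih => exact (wordProd_cons_le _ _ _ _ _).trans (mul_le_mul_right ih _)
  | step c h _ ih => exact (wordProd_cons_le _ _ _ _ _).trans (mul_le_mul_right ih _)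

/-- Deleting the loops of a run and paying `D` for each of them does not lose weight. -/
theorem exists_wordProd_mul_pow_le (r : Run M D k x s m ω) :
    ∃ n, x.length = s.length + n ∧ wordProd M s k m * D ^ n ≤ ω := by
  induction r with
  | nil m => exact ⟨0, by simp⟩
  | loop c hD r ih =>
    obtain ⟨n, hn, h⟩ := ih
    refine ⟨n + 1, by simp [hn, add_assoc], ?_⟩
    rw [pow_succ', mul_left_comm]
    exact mul_le_mul' hD h
  | @step _ l _ _ _ _ c hkl _ ih =>
    obtain ⟨n, hn, h⟩ := ih
    refine ⟨n, by simp [hn, add_right_comm], ?_⟩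
    refine (mul_le_mul_left (wordProd_cons_le _ _ _ l _) _).trans ?_
    rw [mul_assoc]
    exact mul_le_mul_right h _

/-- If the step letters `s` of a run occur in its word as a factor, `x = α s γ`, then all state
changes may be made at or before the letters of that occurrence, all later letters being spent on
loops of weight `D`: the run is followed until it has made `|α|` loops, and from then on the state
changes at each letter until no step is left. -/
theorem wordProd_prefix_mul_pow_le (r : Run M D k x s m ω) {α γ : List Letter}
    (hx : x = α ++ s ++ γ) : wordProd M (α ++ s) k m * D ^ γ.length ≤ ω := by
  induction r generalizing α with
  | nil m =>
    obtain ⟨rfl, rfl⟩ : α = [] ∧ γ = [] := by simpa using hx.symm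
    simp
  | @loop k m x s ω c hD r ih =>
    rcases α with _ | ⟨e, α⟩
    · obtain ⟨n, hn, h⟩ := (r.loop c hD).exists_wordProd_mul_pow_le
      obtain rfl : n = γ.length := by simp [hx] at hn; omega
      exact h
    · obtain ⟨rfl, rfl⟩ : c = e ∧ x = α ++ s ++ γ := by simpa using hx
      refine (mul_le_mul_left (wordProd_cons_le _ _ _ k _) _).trans ?_
      rw [mul_assoc]
      exact mul_le_mul_right (ih rfl) _
  | @step k l m x s ω c hkl r ih =>
    rcases α with _ | ⟨e, α⟩
    · obtain ⟨n, hn, h⟩ := (r.step c hkl).exists_wordProd_mul_pow_le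
      obtain rfl : n = γ.length := by simp [hx] at hn; omega
      exact h
    · obtain ⟨rfl, rfl⟩ : c = e ∧ x = (α ++ [c]) ++ s ++ γ := by simpa using hx
      have h := ih rfl
      rw [List.append_assoc, List.singleton_append] at h
      refine (mul_le_mul_left (wordProd_cons_le _ _ _ l _) _).trans ?_
      rw [mul_assoc]
      exact mul_le_mul_right h _

/-- The mirror image of `Run.wordProd_prefix_mul_pow_le`: all state changes may be made at or after
the letters of an occurrence of `s`, all earlier letters being spent on loops of weight `D`. -/
theorem pow_mul_wordProd_suffix_le (r : Run M D k x s m ω) {α γ : List Letter}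
    (hx : x = α ++ s ++ γ) : D ^ α.length * wordProd M (s ++ γ) k m ≤ ω := by
  induction r generalizing α with
  | nil m =>
    obtain ⟨rfl, rfl⟩ : α = [] ∧ γ = [] := by simpa using hx.symm
    simp
  | @loop k m x s ω c hD r ih =>
    rcases α with _ | ⟨e, α⟩
    · have h := (r.loop c hD).wordProd_le
      rw [hx] at h
      simpa using h
    · obtain ⟨rfl, rfl⟩ : c = e ∧ x = α ++ s ++ γ := by simpa using hx
      rw [List.length_cons, pow_succ', mul_assoc]
      exact mul_le_mul' hD (ih rfl)
  | @step k l m x s ω c hkl r ih =>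
    rcases α with _ | ⟨e, α⟩
    · have h := (r.step c hkl).wordProd_le
      rw [hx] at h
      simpa using h
    · obtain ⟨rfl, rfl⟩ : c = e ∧ x = (α ++ [c]) ++ s ++ γ := by simpa using hx
      have h := ih rfl
      rw [List.length_append, List.length_singleton, ← List.length_cons (a := c)] at h
      refine (mul_le_mul_right (wordProd_cons_le _ _ _ l _) _).trans ?_
      rw [mul_left_comm]
      exact mul_le_mul_right h _

end Run

/-- A nonzero entry of a product is the weight of a run, and the run can be cut at a state whose
loop is the best one it uses. -/
theorem exists_run_run {d : Fin N → 𝕋} (hd : ∀ c i, M c i i = d i)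
    (hM : ∀ c i j, j < i → M c i j = 0) (x : List Letter) (k j : Fin N) :
    wordProd M x k j = 0 ∨ ∃ m x₁ x₂ s₁ s₂ ω₁ ω₂, x = x₁ ++ x₂ ∧ wordProd M x k j = ω₁ * ω₂ ∧
      Run M (d m) k x₁ s₁ m ω₁ ∧ Run M (d m) m x₂ s₂ j ω₂ := by
  induction x generalizing k with
  | nil =>
    by_cases h : k = j
    · subst h
      exact .inr ⟨k, [], [], [], [], 1, 1, rfl, by simp, .nil k, .nil k⟩
    · exact .inl (by simp [h])
  | cons c x ih =>
    obtain ⟨l, -, hl⟩ := exists_sum_eq_apply Finset.univ ⟨k, Finset.mem_univ k⟩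
      fun l => M c k l * wordProd M x l j
    rw [← Matrix.mul_apply, ← wordProd_cons] at hl
    rcases ih l with h0 | ⟨m, x₁, x₂, s₁, s₂, ω₁, ω₂, rfl, hω, r₁, r₂⟩
    · exact .inl (by rw [hl, h0, mul_zero])
    rw [hω] at hl
    rcases lt_trichotomy l k with hlk | rfl | hkl
    · exact .inl (by rw [hl, hM c k l hlk, zero_mul])
    · rcases le_total (d m) (d l) with hml | hlm
      · exact .inr ⟨m, c :: x₁, x₂, s₁, s₂, _, ω₂, rfl, by rw [hl, mul_assoc],
          r₁.loop c (by rwa [hd]), r₂⟩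
      · -- the loop at `l` beats all loops of the rest of the run, so the cut moves to `l`
        exact .inr ⟨l, [], c :: (x₁ ++ x₂), [], s₁ ++ s₂, 1, _, rfl, by rw [hl, one_mul],
          .nil l, ((r₁.mono hlm).append (r₂.mono hlm)).loop c (hd c l).ge⟩
    · exact .inr ⟨m, c :: x₁, x₂, c :: s₁, s₂, _, ω₂, rfl, by rw [hl, mul_assoc],
        r₁.step c hkl, r₂⟩

/-- Changing the central letter of `ū c ū` does not lose weight: the part of an optimal run between
the centre and its best loop can be compressed into one copy of `ū`, away from the centre. -/
theorem wordProd_sandwich_le {d : Fin N → 𝕋} (hd : ∀ c i, M c i i = d i)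
    (hM : ∀ c i j, j < i → M c i j = 0) {ū : List Letter}
    (hū : ∀ s : List Letter, s.length < N → s <:+: ū) (c c' : Letter) (i j : Fin N) :
    wordProd M (sandwich ū c') i j ≤ wordProd M (sandwich ū c) i j := by
  rcases exists_run_run hd hM (sandwich ū c) i j with
    h0 | ⟨m, x₁, x₂, s₁, s₂, ω₁, ω₂, hx, hω, r₁, r₂⟩
  · rw [h0]; exact Tropical.le_zero _
  rw [hω]
  have hd' : ∀ w, wordProd M w m m ≤ d m ^ w.length := wordProd_diag_le fun c => hd c m
  have key : (∃ y, ū = x₁ ++ y ∧ x₂ = y ++ c :: ū) ∨ ∃ y, x₁ = ū ++ c :: y ∧ ū = y ++ x₂ := by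
    rcases List.append_eq_append_iff.1 hx.symm with ⟨y, h₁, h₂⟩ | ⟨y, h₁, h₂⟩
    · exact .inl ⟨y, h₁, h₂⟩
    · rcases y with _ | ⟨e, y⟩
      · exact .inl ⟨[], by simpa using h₁.symm, by simpa using h₂.symm⟩
      · obtain ⟨rfl, h₃⟩ : c = e ∧ ū = y ++ x₂ := by simpa using h₂
        exact .inr ⟨y, h₁, h₃⟩
  rcases key with ⟨y, h₁, rfl⟩ | ⟨y, rfl, h₂⟩
  · have hs := r₂.add_length_le
    obtain ⟨α, β, hαβ⟩ := hū s₂ (by omega)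
    have h := r₂.pow_mul_wordProd_suffix_le (α := y ++ c :: α) (γ := β) (by simp [← hαβ])
    have e : sandwich ū c' = x₁ ++ ((y ++ c' :: α) ++ (s₂ ++ β)) := by
      rw [sandwich]; nth_rw 2 [← hαβ]; rw [h₁]; simp
    rw [e]
    refine (wordProd_append_le _ _ _ m _).trans (mul_le_mul' r₁.wordProd_le ?_)
    refine ((wordProd_append_le _ _ _ m _).trans (mul_le_mul_left (hd' _) _)).trans ?_
    simpa using h
  · have hs := r₁.add_length_le
    obtain ⟨α, β, hαβ⟩ := hū s₁ (by omega)
    have h := r₁.wordProd_prefix_mul_pow_le (α := α) (γ := β ++ c :: y) (by simp [← hαβ])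
    have e : sandwich ū c' = ((α ++ s₁) ++ (β ++ c' :: y)) ++ x₂ := by
      rw [sandwich]; nth_rw 1 [← hαβ]; rw [h₂]; simp
    rw [e]
    refine (wordProd_append_le _ _ _ m _).trans (mul_le_mul' ?_ r₂.wordProd_le)
    refine ((wordProd_append_le _ _ _ m _).trans (mul_le_mul_right (hd' _) _)).trans ?_
    simpa using h

end Runs

/-- If every word of length less than `n` is a factor of `ū`, then `UT_n(𝕋)` satisfies
`ū a ū[ab, ba] = ū b ū[ab, ba]`: the products `AB` and `BA` have the same diagonal. -/
theorem satisfies_sandwichSubst {n : ℕ} {ū : List Letter}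
    (hū : ∀ s : List Letter, s.length < n → s <:+: ū) (c c' : Letter) :
    Satisfies (UT n) (sandwichSubst ū c) (sandwichSubst ū c') := by
  intro φ
  let ψ : FreeSemigroup Letter →ₙ* Matrix (Fin n) (Fin n) 𝕋 :=
    ((MulMemClass.subtype (UT n)).comp φ).comp
      (eval (FreeSemigroup.of a * FreeSemigroup.of b) (FreeSemigroup.of b * FreeSemigroup.of a))
  let A : UT n := φ (FreeSemigroup.of a)
  let B : UT n := φ (FreeSemigroup.of b)
  let d : Fin n → 𝕋 := fun i => A.1 i i * B.1 i i
  have hdiag : ∀ X Y : UT n, ∀ i, (X.1 * Y.1) i i = X.1 i i * Y.1 i i := fun X Y i => by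
    rw [Matrix.mul_apply]
    refine Finset.sum_eq_single i (fun k _ hk => ?_) (by simp)
    rcases hk.lt_or_gt with h | h
    · rw [X.2 i k h, zero_mul]
    · rw [Y.2 k i h, mul_zero]
  have ha : ψ (FreeSemigroup.of a) = A.1 * B.1 := by simp [ψ, A, B, eval]
  have hb : ψ (FreeSemigroup.of b) = B.1 * A.1 := by simp [ψ, A, B, eval]
  have hd : ∀ c i, ψ (FreeSemigroup.of c) i i = d i := fun c i => by
    cases c
    · rw [ha, hdiag]
    · rw [hb, hdiag, mul_comm]
  have hM : ∀ c i j, j < i → ψ (FreeSemigroup.of c) i j = 0 := fun c i j hij =>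
    (φ (eval _ _ (FreeSemigroup.of c))).2 i j hij
  refine Subtype.ext ?_
  change ψ (toWord (sandwich ū c) _) = ψ (toWord (sandwich ū c') _)
  rw [map_toWord ψ (sandwich ū c) (by simp [sandwich]),
    map_toWord ψ (sandwich ū c') (by simp [sandwich])]
  ext i j
  exact le_antisymm (wordProd_sandwich_le hd hM hū c' c i j)
    (wordProd_sandwich_le hd hM hū c c' i j)

/-! ### Matrices that detect a factor -/

section Detect

/-- The real numbers on the diagonal of the matrix substituted for `b`: partial sums that go up by
`1` at each letter `a` of `s` and down by `1` at each `b`. -/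
def height (s : List Letter) : ℕ → ℝ
  | 0 => 0
  | i + 1 => height s i + if s.getD i b = a then 1 else -1

/-- The weight of the loop at state `i`: only the two end states `0` and `|s|` have free loops. -/
noncomputable def loopWeight (s : List Letter) (i : ℕ) : ℝ :=
  if 0 < i ∧ i < s.length then -1 else 0

/-- The matrix substituted for `a`. -/
noncomputable def detectA (s : List Letter) (N : ℕ) : Matrix (Fin N) (Fin N) 𝕋 := fun i j =>
  if j = i then ofReal (loopWeight s i - height s i)
  else if (j : ℕ) = i + 1 then ofReal (-max (height s i) (height s (i + 1))) else 0

/-- The matrix substituted for `b`. -/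
noncomputable def detectB (s : List Letter) (N : ℕ) : Matrix (Fin N) (Fin N) 𝕋 :=
  Matrix.diagonal fun i => ofReal (height s i)

/-- The products `AB` (at the letter `a`) and `BA` (at `b`) of the two matrices: the step from state
`i` to state `i + 1` is free at the `i`-th letter of `s` (counted from `0`) and costs `1` at the
other letter. States beyond `|s|` play no role, so past the end `s` is continued by `b`. -/
noncomputable def detect (s : List Letter) (N : ℕ) (c : Letter) : Matrix (Fin N) (Fin N) 𝕋 :=
  fun i j => if j = i then ofReal (loopWeight s i)
    else if (j : ℕ) = i + 1 then (if c = s.getD i b then 1 else ofReal (-1)) else 0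

variable {s : List Letter} {N : ℕ}

theorem ofReal_le_ofReal {x y : ℝ} : ofReal x ≤ ofReal y ↔ y ≤ x := by
  rw [← Tropical.untrop_le_iff, ofReal, ofReal, Tropical.untrop_trop, Tropical.untrop_trop,
    WithTop.coe_le_coe, OrderDual.toDual_le_toDual]

theorem ofReal_zero : ofReal 0 = 1 := rfl

theorem one_lt_ofReal_neg_one : (1 : 𝕋) < ofReal (-1) := by
  rw [← ofReal_zero, ← not_le, ofReal_le_ofReal]; norm_num

theorem detectA_mem : detectA s N ∈ UT N := fun i j hij => by
  have : (j : ℕ) < i := hij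
  rw [detectA, if_neg hij.ne, if_neg (by omega)]

theorem detectB_mem : detectB s N ∈ UT N := fun _ _ hij => Matrix.diagonal_apply_ne _ hij.ne'

theorem detectA_mul_detectB : detectA s N * detectB s N = detect s N a := by
  ext i j
  rw [detectB, Matrix.mul_diagonal, detectA, detect]
  split_ifs with h₁ h₂ h₃
  · rw [h₁, ofReal_mul_ofReal, sub_add_cancel]
  · rw [h₂, ofReal_mul_ofReal, ← ofReal_zero, height, if_pos h₃.symm,
      max_eq_right (by linarith), neg_add_cancel]
  · rw [h₂, ofReal_mul_ofReal, height, if_neg (Ne.symm h₃), max_eq_left (by linarith)]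
    congr 1; ring
  · rw [zero_mul]

theorem detectB_mul_detectA : detectB s N * detectA s N = detect s N b := by
  ext i j
  rw [detectB, Matrix.diagonal_mul, detectA, detect]
  split_ifs with h₁ h₂ h₃
  · rw [ofReal_mul_ofReal, add_sub_cancel]
  · rw [ofReal_mul_ofReal, ← ofReal_zero, height, ← h₃, if_neg (by simp),
      max_eq_left (by linarith), add_neg_cancel]
  · have h₃ : s.getD i b = a := by cases h : s.getD i b <;> simp_all
    rw [ofReal_mul_ofReal, height, if_pos h₃, max_eq_right (by linarith)]
    congr 1; ring
  · rw [mul_zero]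

theorem one_le_ofReal {x : ℝ} (hx : x ≤ 0) : 1 ≤ ofReal x := by
  rwa [← ofReal_zero, ofReal_le_ofReal]

theorem one_le_detect (c : Letter) (i j : Fin N) : 1 ≤ detect s N c i j := by
  rw [detect]
  split_ifs
  · exact one_le_ofReal (by rw [loopWeight]; split_ifs <;> norm_num)
  · exact le_rfl
  · exact one_lt_ofReal_neg_one.le
  · exact Tropical.le_zero _

theorem one_le_wordProd_detect (w : List Letter) (i j : Fin N) :
    1 ≤ wordProd (detect s N) w i j := by
  induction w generalizing i with
  | nil =>
    rw [wordProd_nil, Matrix.one_apply]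
    split_ifs
    · exact le_rfl
    · exact Tropical.le_zero _
  | cons c w ih =>
    rw [wordProd_cons, Matrix.mul_apply]
    exact le_sum_of_forall_le _ _ fun k _ => one_le_mul (one_le_detect _ _ _) (ih _)

theorem take_succ_eq_concat {k : ℕ} (hk : k < s.length) :
    s.take (k + 1) = s.take k ++ [s.getD k b] := by
  rw [List.take_succ_eq_append_getElem hk, List.getD_eq_getElem _ _ hk]

/-- Reaching an inner state `j` at the end of `w` without cost means that `w` ends in the first `j`
letters of `s`. -/
theorem le_wordProd_detect_of_not_suffix (w : List Letter) {i j : Fin N} (hi : (i : ℕ) = 0)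
    (hj : (j : ℕ) < s.length) (h : ¬ s.take j <:+ w) :
    ofReal (-1) ≤ wordProd (detect s N) w i j := by
  -- the empty word is a suffix of every word
  have hj0 : (j : ℕ) ≠ 0 := fun h0 => h (by simp [h0])
  induction w using List.reverseRecOn generalizing j with
  | nil =>
    rw [wordProd_nil, Matrix.one_apply_ne (by rintro rfl; exact hj0 hi)]
    exact Tropical.le_zero _
  | append_singleton w c ih =>
    rw [wordProd_concat, Matrix.mul_apply]
    refine le_sum_of_forall_le _ _ fun k _ => ?_
    rw [detect]
    split_ifs with h₁ h₂ h₃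
    · subst h₁
      rw [loopWeight, if_pos ⟨by omega, hj⟩]
      exact le_mul_of_one_le_left' (one_le_wordProd_detect _ _ _)
    · rw [mul_one]
      have hk : ¬ s.take k <:+ w := fun hk => h <| by
        rw [h₂, take_succ_eq_concat (by omega), ← h₃]
        obtain ⟨y, hy⟩ := hk
        exact ⟨y, by rw [← hy, List.append_assoc]⟩
      exact ih (by omega) hk fun h0 => hk (by simp [h0])
    · exact le_mul_of_one_le_left' (one_le_wordProd_detect _ _ _)
    · rw [mul_zero]; exact Tropical.le_zero _

/-- Reading `w` from state `0` to state `|s|` without cost means that `s` is a factor of `w`. -/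
theorem le_wordProd_detect_of_not_infix (w : List Letter) {i j : Fin N} (hi : (i : ℕ) = 0)
    (hj : (j : ℕ) = s.length) (h : ¬ s <:+: w) :
    ofReal (-1) ≤ wordProd (detect s N) w i j := by
  have hs : s ≠ [] := by rintro rfl; exact h (List.nil_infix)
  have hs' := List.length_pos_of_ne_nil hs
  induction w using List.reverseRecOn with
  | nil =>
    rw [wordProd_nil, Matrix.one_apply_ne (by rintro rfl; omega)]
    exact Tropical.le_zero _
  | append_singleton w c ih =>
    rw [wordProd_concat, Matrix.mul_apply]
    refine le_sum_of_forall_le _ _ fun k _ => ?_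
    rw [detect]
    split_ifs with h₁ h₂ h₃
    · subst h₁
      refine le_mul_of_le_of_one_le (ih fun h' => h (h'.trans (List.infix_append' [] w [c]))) ?_
      exact one_le_ofReal (by rw [loopWeight]; split_ifs <;> norm_num)
    · rw [mul_one]
      refine le_wordProd_detect_of_not_suffix w hi (by omega) fun hk => h ?_
      obtain ⟨y, hy⟩ := hk
      refine ⟨y, [], ?_⟩
      conv_lhs => rw [← List.take_length (l := s), ← hj, h₂, take_succ_eq_concat (by omega)]
      rw [← hy, h₃]; simp
    · exact le_mul_of_one_le_left' (one_le_wordProd_detect _ _ _)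
    · rw [mul_zero]; exact Tropical.le_zero _

theorem wordProd_detect_take_le {i : Fin N} (hi : (i : ℕ) = 0) (k : ℕ) (hk : k ≤ s.length)
    (hN : k < N) : wordProd (detect s N) (s.take k) i ⟨k, hN⟩ ≤ 1 := by
  induction k with
  | zero =>
    obtain rfl : i = ⟨0, hN⟩ := Fin.ext hi
    simp
  | succ k ih =>
    rw [take_succ_eq_concat hk]
    refine (wordProd_append_le _ _ _ ⟨k, by omega⟩ _).trans (mul_le_one' (ih (by omega) _) ?_)
    rw [wordProd_cons, wordProd_nil, mul_one, detect, if_neg (by simp), if_pos rfl, if_pos rfl]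

theorem wordProd_detect_le_of_infix {w : List Letter} {i j : Fin N} (hi : (i : ℕ) = 0)
    (hj : (j : ℕ) = s.length) (h : s <:+: w) : wordProd (detect s N) w i j ≤ 1 := by
  obtain ⟨x, y, rfl⟩ := h
  have hloop : ∀ k : Fin N, (k : ℕ) = 0 ∨ (k : ℕ) = s.length → ∀ w,
      wordProd (detect s N) w k k ≤ 1 := fun k hk w => by
    refine (wordProd_diag_le (D := 1) (fun c => ?_) w).trans_eq (one_pow _)
    rw [detect, if_pos rfl, loopWeight, if_neg (by omega), ofReal_zero]
  have hs := wordProd_detect_take_le hi s.length le_rfl (hj ▸ j.2)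
  rw [List.take_length, show (⟨s.length, hj ▸ j.2⟩ : Fin N) = j from Fin.ext hj.symm] at hs
  refine (wordProd_append_le _ _ _ j _).trans (mul_le_one' ?_ (hloop j (.inr hj) y))
  exact (wordProd_append_le _ _ _ i _).trans (mul_le_one' (hloop i (.inl hi) x) hs)

/-- A word of length less than `N` that is a factor of exactly one side before substitution makes
`UT_N(𝕋)` violate the identity. -/
theorem not_satisfies_sandwichSubst {ū : List Letter} {c c' : Letter} (hN : s.length < N)
    (h : s <:+: sandwich ū c) (h' : ¬ s <:+: sandwich ū c') :
    ¬ Satisfies (UT N) (sandwichSubst ū c) (sandwichSubst ū c') := by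
  intro hS
  let A : UT N := ⟨detectA s N, detectA_mem⟩
  let B : UT N := ⟨detectB s N, detectB_mem⟩
  let ψ : FreeSemigroup Letter →ₙ* Matrix (Fin N) (Fin N) 𝕋 :=
    ((MulMemClass.subtype (UT N)).comp (eval A B)).comp
      (eval (FreeSemigroup.of a * FreeSemigroup.of b) (FreeSemigroup.of b * FreeSemigroup.of a))
  have hψ : (fun c => ψ (FreeSemigroup.of c)) = detect s N := by
    funext c
    cases c
    · rw [← detectA_mul_detectB]; simp [ψ, A, B, eval]
    · rw [← detectB_mul_detectA]; simp [ψ, A, B, eval]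
  have e : ψ (toWord (sandwich ū c) (by simp [sandwich])) =
      ψ (toWord (sandwich ū c') (by simp [sandwich])) :=
    congrArg (MulMemClass.subtype (UT N)) (hS (eval A B))
  rw [map_toWord ψ _ (by simp [sandwich]), map_toWord ψ _ (by simp [sandwich]), hψ] at e
  have h₁ := wordProd_detect_le_of_infix (i := ⟨0, by omega⟩) (j := ⟨s.length, hN⟩) rfl rfl h
  rw [e] at h₁
  exact absurd ((le_wordProd_detect_of_not_infix _ rfl rfl h').trans h₁)
    one_lt_ofReal_neg_one.not_ge

end Detect

/-! ### The words `ū` contain all words of length `n - 1` -/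

theorem exists_dropSqPrefix_eq (c : Letter) (x : List Letter) :
    x = dropSqPrefix c x ∨ x = c :: c :: dropSqPrefix c x := by
  rcases x with _ | ⟨e, _ | ⟨f, x⟩⟩
  · cases c <;> exact .inl rfl
  · cases c <;> cases e <;> exact .inl rfl
  · cases c <;> cases e <;> cases f <;> first | exact .inl rfl | exact .inr rfl

theorem exists_dropSqSuffix_eq (c : Letter) (x : List Letter) :
    x = dropSqSuffix c x ∨ x = dropSqSuffix c x ++ [c, c] := by
  rcases exists_dropSqPrefix_eq c x.reverse with h | h
  · exact .inl (by rw [dropSqSuffix, ← h, List.reverse_reverse])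
  · refine .inr ?_
    rw [← List.reverse_inj, h]
    simp [dropSqSuffix]

theorem infix_dropSq (c e : Letter) (x : List Letter) :
    x <:+: [c, c] ++ dropSqSuffix e (dropSqPrefix c x) ++ [e, e] := by
  rcases exists_dropSqPrefix_eq c x with h₁ | h₁ <;>
  rcases exists_dropSqSuffix_eq e (dropSqPrefix c x) with h₂ | h₂
  · exact ⟨[c, c], [e, e], by rw [← h₂, ← h₁]⟩
  · refine ⟨[c, c], [], ?_⟩
    conv_lhs => rw [h₁, h₂]
    simp
  · refine ⟨[], [e, e], ?_⟩
    conv_lhs => rw [h₁]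
    rw [← h₂]; simp
  · refine ⟨[], [], ?_⟩
    conv_lhs => rw [h₁, h₂]
    simp

theorem length_dropSqPrefix_le (c : Letter) (x : List Letter) :
    (dropSqPrefix c x).length ≤ x.length := by
  rcases exists_dropSqPrefix_eq c x with h | h
  · exact h ▸ le_rfl
  · conv_rhs => rw [h]
    simp only [List.length_cons]; omega

theorem length_dropSqSuffix_le (c : Letter) (x : List Letter) :
    (dropSqSuffix c x).length ≤ x.length := by
  simpa [dropSqSuffix] using length_dropSqPrefix_le c x.reverse

/-- The block that the word `x` contributes to `ū`: `e` is the letter of the closing square, and `g`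
is the word put behind it. -/
def block (e : Letter) (g x : List Letter) : List Letter :=
  [b, b] ++ dropSqSuffix e (dropSqPrefix b x) ++ [e, e] ++ g

theorem uBar_one (L : List (List Letter)) : uBar 1 L = [] := rfl

theorem uBar_two (L : List (List Letter)) : uBar 2 L = [a, b] := rfl

theorem uBar_three (L : List (List Letter)) : uBar 3 L = [a, b, b, a, a, b] := rfl

theorem uBar_of_even {n : ℕ} (hn : 4 ≤ n) (he : Even n) (L : List (List Letter)) :
    uBar n L = alternating n ++ [b, a] ++ L.flatMap (block a []) ++ [b, b, a] := by
  rw [uBar, if_neg (by omega), if_neg (by omega), if_neg (by omega), if_pos he]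
  congr 4
  funext x
  simp [block]

theorem uBar_of_odd {n : ℕ} (hn : 4 ≤ n) (ho : ¬ Even n) (L : List (List Letter)) :
    uBar n L = alternating n ++ L.flatMap (block b [a]) := by
  rw [uBar, if_neg (by omega), if_neg (by omega), if_neg (by omega), if_neg ho]
  rfl

theorem infix_flatMap_block {e : Letter} {g x : List Letter} {L : List (List Letter)}
    (hx : x ∈ L) : x <:+: L.flatMap (block e g) := by
  refine (infix_dropSq b e x).trans ?_
  refine (List.prefix_append _ g).isInfix.trans (List.infix_of_mem_flatten ?_)
  exact List.mem_map_of_mem hx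

theorem infix_uBar_of_length_eq {n : ℕ} (hn : 1 ≤ n) {L : List (List Letter)}
    (hL : IsWordListing (n - 1) L) {x : List Letter} (hx : x.length = n - 1) :
    x <:+: uBar n L := by
  by_cases h4 : 4 ≤ n
  · by_cases he : Even n
    · rw [uBar_of_even h4 he]
      exact (infix_flatMap_block ((hL.2 x).2 hx)).trans (List.infix_append _ _ _)
    · rw [uBar_of_odd h4 he]
      exact (infix_flatMap_block ((hL.2 x).2 hx)).trans (List.suffix_append _ _).isInfix
  · interval_cases n
    · obtain rfl := List.length_eq_zero_iff.1 hx
      exact List.nil_infix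
    · obtain ⟨c, rfl⟩ := List.length_eq_one_iff.1 hx
      rw [uBar_two]
      cases c <;> decide
    · obtain ⟨c, e, rfl⟩ := List.length_eq_two.1 hx
      rw [uBar_three]
      cases c <;> cases e <;> decide

theorem infix_uBar {n : ℕ} {L : List (List Letter)} (hL : IsWordListing (n - 1) L)
    (x : List Letter) (hx : x.length < n) : x <:+: uBar n L :=
  (List.prefix_append x (List.replicate (n - 1 - x.length) a)).isInfix.trans
    (infix_uBar_of_length_eq (by omega) hL (by simp; omega))

/-! ### An alternating word as a distinguishing factor -/

/-- The other letter. -/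
def other : Letter → Letter
  | a => b
  | b => a

/-- The alternating word of length `k` that begins with `c`. -/
def alt : Letter → ℕ → List Letter
  | _, 0 => []
  | c, k + 1 => c :: alt (other c) k

theorem length_alt (c : Letter) (k : ℕ) : (alt c k).length = k := by
  induction k generalizing c with
  | zero => rfl
  | succ k ih => simp [alt, ih]

theorem other_ne (c : Letter) : other c ≠ c := by cases c <;> decide

theorem other_other (c : Letter) : other (other c) = c := by cases c <;> rfl

theorem isChain_alt (c : Letter) (k : ℕ) : (alt c k).IsChain (· ≠ ·) := by
  induction k generalizing c with
  | zero => exact .nil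
  | succ k ih =>
    rcases k with _ | k
    · exact .singleton c
    · exact .cons_cons (other_ne c).symm (ih _)

theorem alt_add_two (c : Letter) (k : ℕ) :
    alt c (k + 2) = alt c k ++ (if Even k then [c, other c] else [other c, c]) := by
  induction k generalizing c with
  | zero => simp [alt]
  | succ k ih =>
    rw [alt, ih, alt, List.cons_append, other_other]
    simp only [Nat.even_add_one]
    split_ifs <;> simp_all

theorem alt_two_mul (c : Letter) (k : ℕ) : alt c (2 * k) = wordPow [c, other c] k := by
  induction k with
  | zero => rfl
  | succ k ih =>
    rw [mul_add, mul_one, alt, alt, other_other, ih]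
    simp [wordPow, List.replicate_succ]

theorem alternating_eq {n : ℕ} (hn : 2 ≤ n) : alternating n = alt b (n - 1) := by
  rw [alternating]
  split_ifs with h
  · obtain ⟨k, rfl⟩ := h
    rw [show k + k - 1 = 2 * (k - 1) + 1 by omega, show (k + k - 2) / 2 = k - 1 by omega, alt,
      alt_two_mul]
    rfl
  · obtain ⟨k, rfl⟩ := Nat.not_even_iff_odd.1 h
    rw [show 2 * k + 1 - 1 = 2 * k by omega, show 2 * k / 2 = k by omega, alt_two_mul]
    rfl

/-- A word without squares of letters cannot straddle a square `cc`. -/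
theorem infix_of_infix_append_sq {z x y : List Letter} {c : Letter} (hz : z.IsChain (· ≠ ·))
    (h : z <:+: x ++ c :: c :: y) : z <:+: x ++ [c] ∨ z <:+: c :: y := by
  rw [show x ++ c :: c :: y = (x ++ [c]) ++ (c :: y) by simp, List.infix_append_iff_ne_nil] at h
  rcases h with h | h | ⟨s, t, hs, ht, rfl, hs', ht'⟩
  · exact .inl h
  · exact .inr h
  · obtain ⟨s, rfl⟩ : ∃ s₀, s = s₀ ++ [c] := by
      rcases List.suffix_concat_iff.1 hs' with h | ⟨s₀, h, -⟩
      · exact absurd h hs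
      · exact ⟨s₀, h⟩
    obtain ⟨t, rfl⟩ : ∃ t₀, t = c :: t₀ := by
      rcases List.prefix_cons_iff.1 ht' with h | ⟨t₀, h, -⟩
      · exact absurd h ht
      · exact ⟨t₀, h⟩
    rw [List.append_assoc, List.isChain_append] at hz
    simp at hz

theorem not_infix_append_sq {z x y : List Letter} {c : Letter} (hz : z.IsChain (· ≠ ·))
    (hx : ¬ z <:+: x ++ [c]) (hy : ¬ z <:+: c :: y) : ¬ z <:+: x ++ c :: c :: y := fun h =>
  (infix_of_infix_append_sq hz h).elim hx hy

theorem not_infix_of_length_lt {z y : List Letter} (h : y.length < z.length) : ¬ z <:+: y :=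
  fun h' => h.not_ge h'.length_le

/-- A word that neither begins with `b` nor ends with `e` cannot fill `b x e` for a shorter `x`. -/
theorem not_infix_cons_concat {x z₀ z₁ : List Letter} {e f : Letter} (hz : a :: z₁ = z₀ ++ [f])
    (hf : f ≠ e) (hx : x.length < (a :: z₁).length) : ¬ a :: z₁ <:+: b :: (x ++ [e]) := by
  intro h
  rcases List.infix_cons_iff.1 h with h | h
  · obtain ⟨y, hy⟩ := h
    simp at hy
  rcases List.infix_concat_iff.1 h with h | h
  · rw [hz] at h
    rcases List.suffix_concat_iff.1 h with h | ⟨t, h, -⟩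
    · simp at h
    · simp [hf] at h
  · exact not_infix_of_length_lt hx h

/-- Cutting at the squares `b²` and `e²` of the blocks leaves the pieces `b x' e` and the short
pieces `e g b` between consecutive blocks. -/
theorem not_infix_flatMap_block {z : List Letter} (hz : z.IsChain (· ≠ ·)) (hz4 : 4 ≤ z.length)
    {e : Letter} {g : List Letter} (hg : g.length ≤ 1) {L : List (List Letter)}
    (hL : ∀ x ∈ L, ¬ z <:+: b :: (dropSqSuffix e (dropSqPrefix b x) ++ [e])) {x r : List Letter}
    (hx : ¬ z <:+: x ++ [b]) (hr : ¬ z <:+: b :: r) :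
    ¬ z <:+: x ++ L.flatMap (block e g) ++ b :: b :: r := by
  induction L generalizing x with
  | nil => simpa using not_infix_append_sq hz hx hr
  | cons w L ih =>
    have h := ih (fun x hx => hL x (List.mem_cons_of_mem _ hx)) (x := e :: g)
      (not_infix_of_length_lt (by simp; omega))
    have h' := not_infix_append_sq hz (x := b :: dropSqSuffix e (dropSqPrefix b w))
      (by simpa using hL w List.mem_cons_self) h
    simpa [block] using not_infix_append_sq hz hx h'

/-- For `n ≥ 4` the word `abab⋯` of length `n` is a factor of `ū a ū`, at the central letter, but
not of `ū b ū`: it would have to lie between two consecutive squares of letters. -/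
theorem alt_infix_sandwich {n : ℕ} (hn : 4 ≤ n) {L : List (List Letter)}
    (hL : IsWordListing (n - 1) L) :
    alt a n <:+: sandwich (uBar n L) a ∧ ¬ alt a n <:+: sandwich (uBar n L) b := by
  have hz := isChain_alt a n
  have hlen := length_alt a n
  have hT := length_alt b (n - 1)
  have hcons : alt a n = a :: alt b (n - 1) := by
    obtain ⟨k, rfl⟩ : ∃ k, n = k + 1 := ⟨n - 1, by omega⟩
    rfl
  have hblock : ∀ (e f : Letter) (z₀ : List Letter), alt a n = z₀ ++ [f] → f ≠ e → ∀ x ∈ L,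
      ¬ alt a n <:+: b :: (dropSqSuffix e (dropSqPrefix b x) ++ [e]) := by
    intro e f z₀ hz₀ hf x hx
    have h₁ := length_dropSqSuffix_le e (dropSqPrefix b x)
    have h₂ := length_dropSqPrefix_le b x
    have h₃ := (hL.2 x).1 hx
    rw [hcons] at hz₀ ⊢
    refine not_infix_cons_concat hz₀ hf ?_
    rw [List.length_cons, hT]
    omega
  have hTb : ∃ T, alt b (n - 1) = b :: T := by
    obtain ⟨k, rfl⟩ : ∃ k, n = k + 2 := ⟨n - 2, by omega⟩
    exact ⟨_, rfl⟩
  obtain ⟨T, hTb⟩ := hTb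
  have halt := alternating_eq (n := n) (by omega)
  by_cases he : Even n
  · rw [uBar_of_even hn he, halt]
    refine ⟨?_, ?_⟩
    · rw [hcons, sandwich]
      refine (List.prefix_append _ ([b, a] ++ L.flatMap (block a []) ++ [b, b, a])).isInfix.trans
        (List.IsSuffix.isInfix ?_)
      simp only [List.append_assoc, List.cons_append]
      exact ⟨alt b (n - 1) ++ ([b, a] ++ (L.flatMap (block a []) ++ [b, b, a])), by simp⟩
    · have hz₀ : alt a n = alt a (n - 2) ++ [a] ++ [b] := by
        obtain ⟨k, rfl⟩ : ∃ k, n = k + 2 := ⟨n - 2, by omega⟩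
        rw [alt_add_two, if_pos (by grind)]
        simp [other]
      have hT₀ : alt b (n - 1) = alt b (n - 3) ++ [a] ++ [b] := by
        obtain ⟨k, rfl⟩ : ∃ k, n = k + 3 := ⟨n - 3, by omega⟩
        rw [show k + 3 - 1 = k + 2 by omega, alt_add_two, if_neg (by grind)]
        simp [other]
      have hB := hblock a b _ hz₀ (by decide)
      have hbab : ¬ alt a n <:+: [b, a, b] := not_infix_of_length_lt (by simp; omega)
      have hTba : ¬ alt a n <:+: (alt b (n - 1) ++ [b, a]) ++ [b] := by
        have := not_infix_append_sq hz (x := alt b (n - 3) ++ [a]) (c := b) (y := [a, b])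
          (not_infix_of_length_lt (by rw [← hT₀]; omega)) hbab
        rw [hT₀]; simpa using this
      have h₁ := not_infix_flatMap_block hz (by omega) (g := []) (by simp) hB hTba (r := [a])
        (not_infix_of_length_lt (by simp; omega))
      rw [hTb] at h₁
      -- `h₁` treats the second `ū` of `ū b ū`; `h₂` puts the centre `b` and the `a` before it
      -- in front
      have h₂ := not_infix_append_sq hz (x := [b, a]) (c := b) hbab h₁
      have h₃ := not_infix_flatMap_block hz (by omega) (g := []) (by simp) hB hTba h₂
      rw [hTb] at h₃ ⊢
      simpa [sandwich] using h₃
  · rw [uBar_of_odd hn he, halt]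
    refine ⟨?_, ?_⟩
    · rw [hcons, sandwich]
      exact ⟨alt b (n - 1) ++ L.flatMap (block b [a]), L.flatMap (block b [a]), by simp⟩
    · have hz₀ : alt a n = alt a (n - 2) ++ [b] ++ [a] := by
        obtain ⟨k, rfl⟩ : ∃ k, n = k + 2 := ⟨n - 2, by omega⟩
        rw [alt_add_two, if_neg (by grind)]
        simp [other]
      have hB := hblock b a _ hz₀ (by decide)
      -- both words have length `n`, but they begin with different letters
      have hTb' : ¬ alt a n <:+: alt b (n - 1) ++ [b] := by
        intro h
        have := h.eq_of_length (by simp [hlen, hT]; omega)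
        rw [hcons, hTb] at this
        simp at this
      have h₁ := not_infix_flatMap_block hz (by omega) (g := [a]) (by simp) hB hTb' (r := [])
        (not_infix_of_length_lt (by simp; omega))
      have h₂ : ¬ alt a n <:+: b :: (T ++ L.flatMap (block b [a])) := fun h => h₁ <| by
        rw [hTb]
        exact h.trans (List.prefix_append _ _).isInfix
      have h₃ := not_infix_flatMap_block hz (by omega) (g := [a]) (by simp) hB hTb' h₂
      rw [hTb] at h₃ ⊢
      simpa [sandwich] using h₃

theorem exists_distinguishing_factor {n : ℕ} (hn : 1 ≤ n) {L : List (List Letter)}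
    (hL : IsWordListing (n - 1) L) : ∃ w : List Letter, w.length = n ∧
      w <:+: sandwich (uBar n L) a ∧ ¬ w <:+: sandwich (uBar n L) b := by
  by_cases h4 : 4 ≤ n
  · exact ⟨alt a n, length_alt a n, alt_infix_sandwich h4 hL⟩
  · interval_cases n
    · exact ⟨[a], rfl, by rw [uBar_one]; decide⟩
    · exact ⟨[a, a], rfl, by rw [uBar_two]; decide⟩
    · exact ⟨[a, b, a], rfl, by rw [uBar_three]; decide⟩

/-! ### The separating identities -/

/-- An identity of `UT_n(𝕋)` that fails in every larger `UT_N(𝕋)`. -/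
theorem exists_separating_identity {n : ℕ} (hn : 1 ≤ n) : ∃ u v : FreeSemigroup Letter,
    Satisfies (UT n) u v ∧ ∀ N, n < N → ¬ Satisfies (UT N) u v := by
  obtain ⟨L, hL⟩ := exists_isWordListing (n - 1)
  obtain ⟨w, hw, h₁, h₂⟩ := exists_distinguishing_factor hn hL
  exact ⟨_, _, satisfies_sandwichSubst (infix_uBar hL) a b, fun N hN =>
    not_satisfies_sandwichSubst (hw.trans_lt hN) h₁ h₂⟩

theorem variety_ne_of_lt {m n : ℕ} (hm : 1 ≤ m) (hmn : m < n) :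
    variety (UT m) ≠ variety (UT n) := by
  intro h
  obtain ⟨u, v, huv, hN⟩ := exists_separating_identity hm
  have hmem : Semigrp.of (UT n) ∈ variety (UT n) := fun _ _ _ h => h
  rw [← h] at hmem
  exact hN n hmn (hmem Letter u v huv)

end TropicalVarieties

open TropicalVarieties
theorem mainTheorem1 :
    -- an identity of `UT_n` that fails in `UT_{n+1}`
    (∀ n : ℕ, 1 ≤ n → ∃ u v : FreeSemigroup Letter,
      u ≠ v ∧ Satisfies (UT n) u v ∧ ¬ Satisfies (UT (n + 1)) u v) ∧
    -- the generated varieties are pairwise distinct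
    (∀ m n : ℕ, 1 ≤ m → 1 ≤ n → m ≠ n → variety (UT m) ≠ variety (UT n)) ∧
    -- explicit identities, whose sides before substitution are told apart by a factor of length `n`
    (∀ n : ℕ, 1 ≤ n → ∀ L : List (List Letter), IsWordListing (n - 1) L →
      Satisfies (UT n) (sandwichSubst (uBar n L) Letter.a) (sandwichSubst (uBar n L) Letter.b) ∧
      (∃ w : List Letter, w.length = n ∧
        Xor (w <:+: sandwich (uBar n L) Letter.a) (w <:+: sandwich (uBar n L) Letter.b)) ∧
      ¬ Satisfies (UT (n + 1))
          (sandwichSubst (uBar n L) Letter.a) (sandwichSubst (uBar n L) Letter.b)) := by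
  refine ⟨fun n hn => ?_, fun m n hm hn hmn => ?_, fun n hn L hL => ?_⟩
  · obtain ⟨u, v, huv, hN⟩ := exists_separating_identity hn
    refine ⟨u, v, ?_, huv, hN _ n.lt_succ_self⟩
    rintro rfl
    exact hN _ n.lt_succ_self fun _ => rfl
  · rcases hmn.lt_or_gt with h | h
    · exact variety_ne_of_lt hm h
    · exact (variety_ne_of_lt hn h).symm
  · obtain ⟨w, hw, h₁, h₂⟩ := exists_distinguishing_factor hn hL
    exact ⟨satisfies_sandwichSubst (infix_uBar hL) _ _, ⟨w, hw, .inl ⟨h₁, h₂⟩⟩,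
      not_satisfies_sandwichSubst (by omega) h₁ h₂⟩
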